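/- Equip $\mathbb C^3$ with the Hermitian form $\langle v,w\rangle=\bar v_1w_3+\bar v_2w_2+\bar v_3w_1$ of signature $(2,1)$. Let $\mathbf H^2_{\mathbb C}\subset\mathbb{CP}^2$ be the set of negative points, $\partial_\infty\mathbf H^2_{\mathbb C}$ the set of null points, and $\overline{\mathbf H^2_{\mathbb C}}$ their union. For $p,q\in\mathbb C^3$ let $$\mathfrak B(p,q)=\{[z]\in\overline{\mathbf H^2_{\mathbb C}} : |\langle z,p\rangle|=|\langle z,q\rangle|\}.$$ For $\alpha_2\in\mathbb R$ let $$S=\begin{pmatrix}1&\sqrt2e^{-i\alpha_2}&-1\\-\sqrt2e^{i\alpha_2}&-1&0\\-1&0&0\end{pmatrix},\quad T=\begin{pmatrix}0&0&-1\\0&-1&-\sqrt2e^{-i\alpha_2}\\-1&\sqrt2e^{i\alpha_2}&1\end{pmatrix},\quad U=S^{-1}T$$ (elements of $\mathrm{SU}(2,1)$), let $p_U=(1,-\tfrac{\sqrt2}{2}e^{i\alpha_2},e^{2i\alpha_2})$ (a fixed vector of $U$), $p_V=Sp_U$, $p_W=S^2p_U$, $p_A=(1,0,0)$, $p_B=(0,0,1)$,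 and for $k\in\mathbb Z$ let $$\mathcal J_k^+=\mathfrak B(p_U,U^kp_V),\qquad \mathcal J_k^-=\mathfrak B(p_U,U^kp_W).$$ **Proposition.** Suppose that $[U]$ is loxodromic, i.e. that it has no fixed point in $\mathbf H^2_{\mathbb C}$ and exactly two fixed points in $\partial_\infty\mathbf H^2_{\mathbb C}$. Then, for $k\in\mathbb Z$: 1. $\mathcal J_0^+\cap\mathcal J_k^+\neq\emptyset$ if and only if $k\in\{-1,0,1\}$. 2. $\mathcal J_0^-\cap\mathcal J_k^-\neq\emptyset$ if and only if $k\in\{-1,0,1\}$. 3. $\mathcal J_0^+\cap\mathcal J_k^-\neq\emptyset$ if and only if $k\in\{-2,-1,0,1\}$. Furthermore, $\mathcal J_0^+\cap\mathcal J_1^-=\{[Up_A]\}$ and $\mathcal J_0^+\cap\mathcal J_{-2}^-=\{[U^{-1}p_B]\}$. -/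

import Mathlib

open scoped LinearAlgebra.Projectivization Matrix MatrixGroups ComplexConjugate

namespace ParkerWill

noncomputable section

/-- The complex projective plane. -/
abbrev CP2 : Type := ℙ ℂ (Fin 3 → ℂ)

/-- The Hermitian form of signature (2,1) on `ℂ³` given by the antidiagonal matrix with entries 1
(antilinear in the first variable). -/
def herm (v w : Fin 3 → ℂ) : ℂ :=
  conj (v 0) * w 2 + conj (v 1) * w 1 + conj (v 2) * w 0

theorem herm_smul_smul (c d : ℂ) (v w : Fin 3 → ℂ) :
    herm (c • v) (d • w) = conj c * d * herm v w := by
  simp only [herm, Pi.smul_apply, smul_eq_mul, map_mul]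
  ring

theorem herm_smul_self_re (c : ℂ) (v : Fin 3 → ℂ) :
    (herm (c • v) (c • v)).re = Complex.normSq c * (herm v v).re := by
  rw [herm_smul_smul, mul_comm (conj c), Complex.mul_conj, Complex.re_ofReal_mul]

/-- The complex hyperbolic plane: the negative points of `CP2`. -/
def H2 : Set CP2 := {x | (herm x.rep x.rep).re < 0}

/-- The boundary at infinity of the complex hyperbolic plane: the null points of `CP2`. -/
def bdryH2 : Set CP2 := {x | (herm x.rep x.rep).re = 0}

/-- The bisector of `p` and `q` in the closed complex hyperbolic plane (boundary at infinity
included). -/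
def bisector (p q : Fin 3 → ℂ) : Set CP2 :=
  {x | x ∈ H2 ∪ bdryH2 ∧ ‖herm x.rep p‖ = ‖herm x.rep q‖}

/-- The definitions above do not depend on the chosen representatives. -/
theorem exists_rep_eq (v : Fin 3 → ℂ) (hv : v ≠ 0) :
    ∃ c : ℂ, c ≠ 0 ∧ (Projectivization.mk ℂ v hv).rep = c • v := by
  obtain ⟨a, ha⟩ := Projectivization.exists_smul_eq_mk_rep ℂ v hv
  exact ⟨a, a.ne_zero, ha.symm⟩

theorem mk_mem_H2 (v : Fin 3 → ℂ) (hv : v ≠ 0) :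
    Projectivization.mk ℂ v hv ∈ H2 ↔ (herm v v).re < 0 := by
  obtain ⟨c, hc, h⟩ := exists_rep_eq v hv
  have hc' := Complex.normSq_pos.mpr hc
  simp only [H2, Set.mem_ofPred_eq, h, herm_smul_self_re]
  exact ⟨fun h1 => by by_contra h2; exact absurd h1 (not_lt.mpr (by nlinarith)),
    fun h1 => by nlinarith⟩

theorem mk_mem_bdryH2 (v : Fin 3 → ℂ) (hv : v ≠ 0) :
    Projectivization.mk ℂ v hv ∈ bdryH2 ↔ (herm v v).re = 0 := by
  obtain ⟨c, hc, h⟩ := exists_rep_eq v hv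
  simp [bdryH2, h, herm_smul_self_re, hc]

theorem mk_mem_bisector (v p q : Fin 3 → ℂ) (hv : v ≠ 0) :
    Projectivization.mk ℂ v hv ∈ bisector p q ↔
      (herm v v).re ≤ 0 ∧ ‖herm v p‖ = ‖herm v q‖ := by
  obtain ⟨c, hc, h⟩ := exists_rep_eq v hv
  have h1 (w : Fin 3 → ℂ) : herm (c • v) w = conj c * herm v w := by
    simpa using herm_smul_smul c 1 v w
  simp only [bisector, Set.mem_ofPred_eq, Set.mem_union, mk_mem_H2, mk_mem_bdryH2,
    ← le_iff_lt_or_eq, h, h1, norm_mul, RCLike.norm_conj]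
  simp [hc]

/-- An isometry is loxodromic if it has no fixed point in the complex hyperbolic plane and exactly
two fixed points in its boundary at infinity. -/
def IsLoxodromic (A : SL(3, ℂ)) : Prop :=
  (∀ x ∈ H2, A • x ≠ x) ∧ {x : CP2 | x ∈ bdryH2 ∧ A • x = x}.ncard = 2

/-- `e^{iα}`. -/
def e (α : ℝ) : ℂ := Complex.exp (α * Complex.I)

theorem e_mul_conj (α : ℝ) : e α * conj (e α) = 1 := by
  rw [e, Complex.mul_conj, Complex.normSq_eq_norm_sq, Complex.norm_exp_ofReal_mul_I]
  simp

theorem sqrt_two_mul_self : ((√2 : ℝ) : ℂ) * ((√2 : ℝ) : ℂ) = 2 := by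
  rw [← Complex.ofReal_mul, Real.mul_self_sqrt (by norm_num)]
  norm_num

/-- The order 3 generator `S`. -/
def S (α : ℝ) : SL(3, ℂ) :=
  ⟨!![1, (√2 : ℝ) * conj (e α), -1;
      -(√2 : ℝ) * e α, -1, 0;
      -1, 0, 0], by
    simp [Matrix.det_fin_three]⟩

/-- The order 3 generator `T`. -/
def T (α : ℝ) : SL(3, ℂ) :=
  ⟨!![0, 0, -1;
      0, -1, -(√2 : ℝ) * conj (e α);
      -1, (√2 : ℝ) * e α, 1], by
    simp [Matrix.det_fin_three]⟩

theorem SL_smul (A : SL(3, ℂ)) (v : Fin 3 → ℂ) : A • v = A.1 *ᵥ v := rfl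

/-- `S` preserves the Hermitian form. -/
theorem herm_S (α : ℝ) (v w : Fin 3 → ℂ) : herm (S α • v) (S α • w) = herm v w := by
  have h1 := e_mul_conj α
  have h2 := sqrt_two_mul_self
  simp only [herm, SL_smul]
  simp only [S, Matrix.mulVec, dotProduct,
    Fin.sum_univ_three, Matrix.of_apply, Matrix.cons_val, map_add, map_mul, map_neg,
    Complex.conj_ofReal, Complex.conj_conj, map_one, map_zero]
  linear_combination (2 * conj (v 0) * w 0) * h1 + (e α * conj (e α) * conj (v 0) * w 0) * h2

/-- `T` preserves the Hermitian form. -/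
theorem herm_T (α : ℝ) (v w : Fin 3 → ℂ) : herm (T α • v) (T α • w) = herm v w := by
  have h1 := e_mul_conj α
  have h2 := sqrt_two_mul_self
  simp only [herm, SL_smul]
  simp only [T, Matrix.mulVec, dotProduct,
    Fin.sum_univ_three, Matrix.of_apply, Matrix.cons_val, map_add, map_mul, map_neg,
    Complex.conj_ofReal, Complex.conj_conj, map_one, map_zero]
  linear_combination (2 * conj (v 2) * w 2) * h1 + (e α * conj (e α) * conj (v 2) * w 2) * h2

/-- `U = S⁻¹T`. -/
def U (α : ℝ) : SL(3, ℂ) := (S α)⁻¹ * T α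

/-- The fixed vector of `U`. -/
def pU (α : ℝ) : Fin 3 → ℂ := ![1, -((√2 : ℝ) / 2) * e α, e α ^ 2]

def pV (α : ℝ) : Fin 3 → ℂ := S α • pU α

def pW (α : ℝ) : Fin 3 → ℂ := S α ^ 2 • pU α

/-- `S` and `T` agree on `p_U`, so `U = S⁻¹T` fixes `p_U`. -/
theorem U_smul_pU (α : ℝ) : U α • pU α = pU α := by
  rw [U, mul_smul, inv_smul_eq_iff]
  have h1 := e_mul_conj α
  have h2 := sqrt_two_mul_self
  funext i
  fin_cases i
  all_goals
    simp only [SL_smul]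
    simp [S, T, pU, Matrix.mulVec, dotProduct,
      Fin.sum_univ_three]
  · linear_combination -(e α * conj (e α) / 2) * h2 - h1
  · linear_combination (-(√2 : ℝ) * e α) * h1
  · linear_combination (- e α ^ 2 / 2) * h2

/-- The point `[p_A]`. -/
def pA : CP2 := Projectivization.mk ℂ ![1, 0, 0] (by simp)

/-- The point `[p_B]`. -/
def pB : CP2 := Projectivization.mk ℂ ![0, 0, 1] (by simp)

/-- The bisector `J_k^+`. -/
def Jplus (α : ℝ) (k : ℤ) : Set CP2 := bisector (pU α) (U α ^ k • pV α)

/-- The bisector `J_k^-`. -/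
def Jminus (α : ℝ) (k : ℤ) : Set CP2 := bisector (pU α) (U α ^ k • pW α)

end

end ParkerWill

namespace ParkerWill

/-! Write `p = pU α`, let `q` be `pV α` or `pW α`, let `r` be a `U^k`-translate of one of them, and
put `N = ⟨p, p⟩`, `g = ⟨q, r⟩`. The three vectors all have norm `N`, and `⟨p, q⟩ = ⟨p, r⟩ = -3/2`,
so the Gram matrix depends on `N` and `g` only. A common point `z` of the two bisectors has products
of equal modulus `t` with `p`, `q`, `r`, and the adjugate of the Gram matrix expresses `gramDet N g
* ⟨z, z⟩` through these products. For `N > 0` the triangle inequality bounds that expression by `t²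
(3N + 6 - |g|)(|g| + N)`, while for `gramDet N g < 0` and `⟨z, z⟩ ≤ 0` it is nonnegative. Hence `|g|
> 3N + 6` leaves no common point, and in the borderline case `g = -(3N + 6)` equality throughout
leaves at most one.

Loxodromy gives `N > 0`. The identity `U + U⁻¹ = (2N + 2) - 2⟨p, ·⟩p` (`U_add_U_inv`) turns the
products along an orbit into a second-order recursion. For the pair `pV`, `pW` the values at `k = 0`
and `k = -1` are both `-3/2`, so those at `1` and `-2` are exactly `-(3N + 6)`, and beyond them the
modulus is larger. For `pV`, `pV` and `pW`, `pW` the threshold is passed from `|k| = 2` on. The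
remaining intersections contain `pA`, `pB` or their translates. -/

theorem herm_conj (v w : Fin 3 → ℂ) : conj (herm v w) = herm w v := by
  simp only [herm, map_add, map_mul, Complex.conj_conj]
  ring

theorem herm_add_left (u v w : Fin 3 → ℂ) : herm (u + v) w = herm u w + herm v w := by
  simp only [herm, Pi.add_apply, map_add]
  ring

theorem herm_add_right (u v w : Fin 3 → ℂ) : herm u (v + w) = herm u v + herm u w := by
  simp only [herm, Pi.add_apply]
  ring

theorem herm_smul_left (c : ℂ) (v w : Fin 3 → ℂ) : herm (c • v) w = conj c * herm v w := by
  simpa using herm_smul_smul c 1 v w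

theorem herm_smul_right (c : ℂ) (v w : Fin 3 → ℂ) : herm v (c • w) = c * herm v w := by
  simpa using herm_smul_smul 1 c v w

theorem herm_self_eq_re (v : Fin 3 → ℂ) : herm v v = ((herm v v).re : ℂ) :=
  (Complex.conj_eq_iff_re.mp (herm_conj v v)).symm

/-- The determinant of the Gram matrix of three vectors `p`, `q`, `r` of norm `N` such that
`⟨p, q⟩ = ⟨p, r⟩ = -3/2` and `⟨q, r⟩ = g`. -/
noncomputable def gramDet (N : ℝ) (g : ℂ) : ℝ :=
  N ^ 3 - 9 / 2 * N + 9 / 2 * g.re - N * ‖g‖ ^ 2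

/-- A triple of vectors of norm `N` with `⟨p, q⟩ = ⟨p, r⟩ = -3/2` and `⟨q, r⟩ = g`. -/
structure GramTriple (N : ℝ) (g : ℂ) (p q r : Fin 3 → ℂ) : Prop where
  pp : herm p p = N
  qq : herm q q = N
  rr : herm r r = N
  pq : herm p q = -3 / 2
  pr : herm p r = -3 / 2
  qr : herm q r = g

/-! ### Gram matrices and intersections of two bisectors -/

section Gram

variable {N : ℝ} {g : ℂ} {p q r : Fin 3 → ℂ}

theorem GramTriple.qp (h : GramTriple N g p q r) : herm q p = -3 / 2 := by
  rw [← herm_conj, h.pq]; simp [map_ofNat]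

theorem GramTriple.rp (h : GramTriple N g p q r) : herm r p = -3 / 2 := by
  rw [← herm_conj, h.pr]; simp [map_ofNat]

theorem GramTriple.rq (h : GramTriple N g p q r) : herm r q = conj g := by
  rw [← herm_conj, h.qr]

theorem gramDet_eq (N : ℝ) (g : ℂ) :
    (gramDet N g : ℂ) = N ^ 3 - 9 / 2 * N + 9 / 4 * (g + conj g) - N * (g * conj g) := by
  rw [Complex.add_conj, Complex.mul_conj, Complex.normSq_eq_norm_sq, gramDet]
  push_cast
  ring

/-- The determinant of the matrix with columns `p`, `q`, `r`. -/
def det3 (p q r : Fin 3 → ℂ) : ℂ :=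
  p 0 * (q 1 * r 2 - q 2 * r 1) - p 1 * (q 0 * r 2 - q 2 * r 0) + p 2 * (q 0 * r 1 - q 1 * r 0)

/-- The Gram determinant is `|det|²` times the determinant `-1` of the antidiagonal form. -/
theorem gram_det_eq (p q r : Fin 3 → ℂ) :
    herm p p * (herm q q * herm r r - herm q r * herm r q)
      - herm p q * (herm q p * herm r r - herm q r * herm r p)
      + herm p r * (herm q p * herm r q - herm q q * herm r p) =
    -(conj (det3 p q r) * det3 p q r) := by
  simp only [herm, det3, map_add, map_mul, map_sub]
  ring

theorem GramTriple.exists_coords (h : GramTriple N g p q r) (hd : gramDet N g ≠ 0)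
    (z : Fin 3 → ℂ) : ∃ a b c : ℂ, z = a • p + b • q + c • r := by
  have hD : det3 p q r ≠ 0 := by
    intro h0
    have h1 := gram_det_eq p q r
    rw [h0, h.pp, h.qq, h.rr, h.pq, h.pr, h.qr, h.qp, h.rp, h.rq] at h1
    apply hd
    have h2 := gramDet_eq N g
    have : (gramDet N g : ℂ) = 0 := by
      rw [h2]
      linear_combination h1
    exact_mod_cast this
  -- Cramer's rule.
  refine ⟨det3 z q r / det3 p q r, det3 p z r / det3 p q r, det3 p q z / det3 p q r, ?_⟩
  funext i
  simp only [Pi.add_apply, Pi.smul_apply, smul_eq_mul]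
  field_simp
  fin_cases i <;> simp only [det3, Fin.zero_eta, Fin.mk_one, Fin.reduceFinMk] <;> ring

theorem GramTriple.eq_zero (h : GramTriple N g p q r) (hd : gramDet N g ≠ 0)
    {z : Fin 3 → ℂ} (hp : herm z p = 0) (hq : herm z q = 0) (hr : herm z r = 0) : z = 0 := by
  obtain ⟨a, b, c, hz⟩ := h.exists_coords hd z
  have hd' : (gramDet N g : ℂ) ≠ 0 := by exact_mod_cast hd
  have h2 := gramDet_eq N g
  rw [hz] at hp hq hr
  simp only [herm_add_left, herm_smul_left, h.pp, h.qq, h.rr, h.pq, h.pr, h.qr, h.qp, h.rp, h.rq]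
    at hp hq hr
  -- The multipliers here and below are the entries of the adjugate of the Gram matrix.
  have ha : (gramDet N g : ℂ) * conj a = 0 := by
    rw [h2]
    linear_combination (N ^ 2 - g * conj g) * hp + (3 / 2 * N - 3 / 2 * g) * hq
      + (3 / 2 * N - 3 / 2 * conj g) * hr
  have hb : (gramDet N g : ℂ) * conj b = 0 := by
    rw [h2]
    linear_combination (3 / 2 * N - 3 / 2 * conj g) * hp + (N ^ 2 - 9 / 4) * hq
      + (9 / 4 - N * conj g) * hr
  have hc : (gramDet N g : ℂ) * conj c = 0 := by
    rw [h2]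
    linear_combination (3 / 2 * N - 3 / 2 * g) * hp + (9 / 4 - N * g) * hq
      + (N ^ 2 - 9 / 4) * hr
  simp only [mul_eq_zero, hd', false_or, map_eq_zero] at ha hb hc
  simp [hz, ha, hb, hc]

/-- The norm of `z` in terms of its products with the vectors of a triple, through the adjugate of
the Gram matrix. -/
theorem GramTriple.gramDet_mul_herm (h : GramTriple N g p q r) (hd : gramDet N g ≠ 0)
    (z : Fin 3 → ℂ) :
    gramDet N g * (herm z z).re =
      (N ^ 2 - ‖g‖ ^ 2) * ‖herm z p‖ ^ 2 + (N ^ 2 - 9 / 4) * (‖herm z q‖ ^ 2 + ‖herm z r‖ ^ 2)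
      + 3 * ((N - conj g) * (conj (herm z q) * herm z p)).re
      + 3 * ((N - g) * (conj (herm z r) * herm z p)).re
      + 2 * ((9 / 4 - N * conj g) * (conj (herm z q) * herm z r)).re := by
  obtain ⟨a, b, c, hz⟩ := h.exists_coords hd z
  apply Complex.ofReal_injective
  have hre (w : ℂ) : (w.re : ℂ) = (w + conj w) / 2 := by rw [Complex.add_conj]; push_cast; ring
  have hn (w : ℂ) : ((‖w‖ : ℝ) : ℂ) ^ 2 = w * conj w := by
    rw [Complex.mul_conj, Complex.normSq_eq_norm_sq]; push_cast; ring
  push_cast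
  rw [gramDet_eq, ← herm_self_eq_re, hn, hn, hn, hn, hre, hre, hre, hz]
  simp only [herm_add_left, herm_smul_left, herm_add_right, herm_smul_right,
    h.pp, h.qq, h.rr, h.pq, h.pr, h.qr, h.qp, h.rp, h.rq, map_add, map_mul, map_sub, map_div₀,
    map_neg, map_ofNat, Complex.conj_conj, Complex.conj_ofReal]
  ring

theorem re_mul_le {u w : ℂ} {s t : ℝ} (hu : ‖u‖ ≤ s) (hw : ‖w‖ ≤ t) : (u * w).re ≤ s * t :=
  (Complex.re_le_norm _).trans (by
    rw [norm_mul]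
    exact mul_le_mul hu hw (norm_nonneg _) ((norm_nonneg _).trans hu))

theorem GramTriple.eq_zero_of_norm_eq (h : GramTriple N g p q r) (hN : 0 < N)
    (hd : gramDet N g < 0) (hg : 3 * N + 6 < ‖g‖) {z : Fin 3 → ℂ} (hz : (herm z z).re ≤ 0)
    (hq : ‖herm z p‖ = ‖herm z q‖) (hr : ‖herm z p‖ = ‖herm z r‖) : z = 0 := by
  have key := h.gramDet_mul_herm hd.ne z
  have hpos : 0 ≤ gramDet N g * (herm z z).re := mul_nonneg_of_nonpos_of_nonpos hd.le hz
  have hNn : ‖(N : ℂ)‖ = N := by simp [hN.le]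
  have h1 : ‖(N : ℂ) - g‖ ≤ N + ‖g‖ := (norm_sub_le _ _).trans (by rw [hNn])
  have h2 : ‖(N : ℂ) - conj g‖ ≤ N + ‖g‖ :=
    (norm_sub_le _ _).trans (by rw [hNn, RCLike.norm_conj])
  have h3 : ‖9 / 4 - (N : ℂ) * conj g‖ ≤ 9 / 4 + N * ‖g‖ :=
    (norm_sub_le _ _).trans (by rw [norm_mul, hNn, RCLike.norm_conj]; norm_num)
  have hnorm {u v : Fin 3 → ℂ} (hu : ‖herm z p‖ = ‖herm z u‖) (hv : ‖herm z p‖ = ‖herm z v‖) :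
      ‖conj (herm z u) * herm z v‖ ≤ ‖herm z p‖ ^ 2 := by
    rw [norm_mul, RCLike.norm_conj, ← hu, ← hv, sq]
  have e1 := re_mul_le h2 (hnorm hq rfl)
  have e2 := re_mul_le h1 (hnorm hr rfl)
  have e3 := re_mul_le h3 (hnorm hq hr)
  rw [← hq, ← hr] at key
  -- With all three moduli equal, the coefficients of the bound add up to `3N² + 2N‖g‖ + 6N + 6‖g‖ -
  -- ‖g‖²`, which factors; this is where the threshold `3N + 6` comes from.
  have hle : 0 ≤ ‖herm z p‖ ^ 2 * ((3 * N + 6 - ‖g‖) * (‖g‖ + N)) := by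
    linarith
  have h0 : ‖herm z p‖ = 0 := by
    by_contra hne
    have : 0 < ‖herm z p‖ ^ 2 := by positivity
    have h5 : (3 * N + 6 - ‖g‖) * (‖g‖ + N) < 0 :=
      mul_neg_of_neg_of_pos (by linarith) (by positivity)
    nlinarith
  exact h.eq_zero hd.ne (norm_eq_zero.mp h0) (norm_eq_zero.mp (hq ▸ h0))
    (norm_eq_zero.mp (hr ▸ h0))

/-- The equality case of Cauchy–Schwarz: expanding gives `|u - w|² ≤ 0`. -/
theorem eq_of_norm_eq_of_re {u w : ℂ} (h : ‖u‖ = ‖w‖) (hre : ‖w‖ ^ 2 ≤ (conj u * w).re) :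
    u = w := by
  have h1 : Complex.normSq (u - w) ≤ 0 := by
    have hu : Complex.normSq u = ‖w‖ ^ 2 := by rw [Complex.normSq_eq_norm_sq, h]
    have hw : Complex.normSq w = ‖w‖ ^ 2 := Complex.normSq_eq_norm_sq w
    have h2 : (u * conj w).re = (conj u * w).re := by simp [Complex.mul_re]
    rw [Complex.normSq_sub, hu, hw, h2]
    linarith
  exact sub_eq_zero.mp (Complex.normSq_eq_zero.mp (le_antisymm h1 (Complex.normSq_nonneg _)))

/-- For this `g` the coefficients of the cross terms are positive reals and the upper bound is
exactly zero, so the cross terms involving `p` must attain their maximal values. -/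
theorem GramTriple.herm_eq_of_norm_eq (h : GramTriple N (-(3 * N + 6) : ℝ) p q r) (hN : 0 < N)
    (hd : gramDet N (-(3 * N + 6) : ℝ) < 0) {z : Fin 3 → ℂ} (hz : (herm z z).re ≤ 0)
    (hq : ‖herm z p‖ = ‖herm z q‖) (hr : ‖herm z p‖ = ‖herm z r‖) :
    herm z q = herm z p ∧ herm z r = herm z p := by
  have key := h.gramDet_mul_herm hd.ne z
  have hpos : 0 ≤ gramDet N (-(3 * N + 6) : ℝ) * (herm z z).re :=
    mul_nonneg_of_nonpos_of_nonpos hd.le hz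
  have hg : ‖((-(3 * N + 6) : ℝ) : ℂ)‖ = 3 * N + 6 := by
    rw [Complex.norm_real, norm_neg, Real.norm_of_nonneg (by positivity)]
  have c1 (w : ℂ) : ((N - ((-(3 * N + 6) : ℝ) : ℂ)) * w).re = (4 * N + 6) * w.re := by
    rw [← Complex.ofReal_sub, Complex.re_ofReal_mul]; ring
  have c2 (w : ℂ) : ((9 / 4 - N * ((-(3 * N + 6) : ℝ) : ℂ)) * w).re =
      (9 / 4 + N * (3 * N + 6)) * w.re := by
    rw [show (9 / 4 - N * ((-(3 * N + 6) : ℝ) : ℂ)) = ((9 / 4 + N * (3 * N + 6) : ℝ) : ℂ) by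
      push_cast; ring, Complex.re_ofReal_mul]
  rw [hg, Complex.conj_ofReal, c1, c1, c2, ← hq, ← hr] at key
  have hnorm {u v : Fin 3 → ℂ} (hu : ‖herm z p‖ = ‖herm z u‖) (hv : ‖herm z p‖ = ‖herm z v‖) :
      (conj (herm z u) * herm z v).re ≤ ‖herm z p‖ ^ 2 :=
    (Complex.re_le_norm _).trans (by rw [norm_mul, RCLike.norm_conj, ← hu, ← hv, sq])
  have e1 := hnorm hq rfl
  have e2 := hnorm hr rfl
  have e3 := mul_le_mul_of_nonneg_left (hnorm hq hr)
    (show 0 ≤ 9 / 4 + N * (3 * N + 6) by positivity)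
  exact ⟨eq_of_norm_eq_of_re hq.symm (by nlinarith), eq_of_norm_eq_of_re hr.symm (by nlinarith)⟩

theorem bisector_inter_eq_empty (h : GramTriple N g p q r) (hN : 0 < N)
    (hd : gramDet N g < 0) (hg : 3 * N + 6 < ‖g‖) : bisector p q ∩ bisector p r = ∅ := by
  rw [Set.eq_empty_iff_forall_notMem]
  intro x
  induction x using Projectivization.ind with
  | h v hv =>
    rw [Set.mem_inter_iff, mk_mem_bisector, mk_mem_bisector]
    rintro ⟨⟨h1, h2⟩, -, h3⟩
    exact hv (h.eq_zero_of_norm_eq hN hd hg h1 h2 h3)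

theorem bisector_inter_subsingleton (h : GramTriple N (-(3 * N + 6) : ℝ) p q r) (hN : 0 < N) :
    (bisector p q ∩ bisector p r).Subsingleton := by
  have hd : gramDet N (-(3 * N + 6) : ℝ) < 0 := by
    rw [gramDet, Complex.norm_real, norm_neg, Real.norm_of_nonneg (by positivity),
      Complex.ofReal_re]
    nlinarith [pow_pos hN 3, pow_pos hN 2]
  intro x hx y hy
  induction x using Projectivization.ind with
  | h v hv =>
    induction y using Projectivization.ind with
    | h w hw =>
      rw [Set.mem_inter_iff, mk_mem_bisector, mk_mem_bisector] at hx hy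
      obtain ⟨h1, h2⟩ := h.herm_eq_of_norm_eq hN hd hx.1.1 hx.1.2 hx.2.2
      obtain ⟨h3, h4⟩ := h.herm_eq_of_norm_eq hN hd hy.1.1 hy.1.2 hy.2.2
      have hv0 : herm v p ≠ 0 := fun h0 =>
        hv (h.eq_zero hd.ne h0 (h1.trans h0) (h2.trans h0))
      have hw0 : herm w p ≠ 0 := fun h0 =>
        hw (h.eq_zero hd.ne h0 (h3.trans h0) (h4.trans h0))
      -- Rescaling `w` to have the same product with `p` as `v` makes the difference orthogonal to
      -- the whole triple. The conjugate is due to antilinearity in the first slot.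
      have hz : v + (-(conj (herm v p / herm w p))) • w = 0 := by
        apply h.eq_zero hd.ne <;>
          simp only [herm_add_left, herm_smul_left, map_neg, Complex.conj_conj, h1, h2, h3, h4] <;>
          field_simp <;> ring
      rw [Projectivization.mk_eq_mk_iff']
      refine ⟨conj (herm v p / herm w p), ?_⟩
      rw [neg_smul, ← sub_eq_add_neg, sub_eq_zero] at hz
      exact hz.symm

end Gram

/-- The norm of the fixed vector of `U`. -/
noncomputable def normU (α : ℝ) : ℝ := 1 / 2 + 2 * (e α ^ 2).re

/-! ### Coordinates and the action of `U` -/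

theorem normU_eq (α : ℝ) : (normU α : ℂ) = 1 / 2 + e α ^ 2 + conj (e α) ^ 2 := by
  have h := Complex.add_conj (e α ^ 2)
  rw [map_pow] at h
  rw [normU]
  push_cast at h ⊢
  linear_combination -h

theorem pV_eq (α : ℝ) : pV α = ![-e α ^ 2, -((√2 : ℝ) / 2) * e α, -1] := by
  have h1 := e_mul_conj α
  have h2 := sqrt_two_mul_self
  funext i
  rw [pV, SL_smul]
  fin_cases i <;> simp [S, pU, Matrix.mulVec, dotProduct, Fin.sum_univ_three]
  · linear_combination -(e α * conj (e α) / 2) * h2 - h1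
  · ring

theorem pW_eq (α : ℝ) :
    pW α = ![-e α ^ 2, (√2 : ℝ) * e α ^ 3 + (√2 : ℝ) / 2 * e α, e α ^ 2] := by
  have h1 := e_mul_conj α
  have h2 := sqrt_two_mul_self
  have h : pW α = S α • pV α := by rw [pW, pV, sq, mul_smul]
  rw [h, pV_eq]
  funext i
  rw [SL_smul]
  fin_cases i <;> simp [S, Matrix.mulVec, dotProduct, Fin.sum_univ_three]
  · linear_combination -(e α * conj (e α) / 2) * h2 - h1
  · ring

theorem T_smul (α : ℝ) (v : Fin 3 → ℂ) : T α • v =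
    ![-v 2, -v 1 - (√2 : ℝ) * conj (e α) * v 2, -v 0 + (√2 : ℝ) * e α * v 1 + v 2] := by
  funext i
  rw [SL_smul]
  fin_cases i <;> simp [T, Matrix.mulVec, dotProduct, Fin.sum_univ_three]
  ring

theorem S_smul (α : ℝ) (v : Fin 3 → ℂ) : S α • v =
    ![v 0 + (√2 : ℝ) * conj (e α) * v 1 - v 2, -(√2 : ℝ) * e α * v 0 - v 1, -v 0] := by
  funext i
  rw [SL_smul]
  fin_cases i <;> simp [S, Matrix.mulVec, dotProduct, Fin.sum_univ_three]
  all_goals ring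

theorem U_smul (α : ℝ) (v : Fin 3 → ℂ) : U α • v =
    ![v 0 - (√2 : ℝ) * e α * v 1 - v 2,
      (√2 : ℝ) * e α * (-v 0 + (√2 : ℝ) * e α * v 1 + v 2) + v 1 + (√2 : ℝ) * conj (e α) * v 2,
      -v 0 + (√2 : ℝ) * (e α + conj (e α)) * v 1 + 2 * (1 + conj (e α) ^ 2) * v 2] := by
  have h1 := e_mul_conj α
  have h2 := sqrt_two_mul_self
  rw [U, mul_smul, inv_smul_eq_iff, T_smul, S_smul]
  funext i
  fin_cases i <;> simp
  · linear_combination ((√2 : ℝ) * (√2 : ℝ) * v 0 - (√2 : ℝ) * (√2 : ℝ) * v 2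
        - (√2 : ℝ) * (√2 : ℝ) * (√2 : ℝ) * e α * v 1) * h1
      + (v 0 - v 2 - (√2 : ℝ) * e α * v 1 - conj (e α) ^ 2 * v 2) * h2
  · ring
  · ring

theorem U_inv_smul (α : ℝ) (v : Fin 3 → ℂ) : (U α)⁻¹ • v =
    ![2 * (1 + e α ^ 2) * v 0 + (√2 : ℝ) * (e α + conj (e α)) * v 1 - v 2,
      (√2 : ℝ) * e α * v 0 + v 1 + (√2 : ℝ) * conj (e α) * v 0 + 2 * conj (e α) ^ 2 * v 1
        - (√2 : ℝ) * conj (e α) * v 2,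
      -v 0 - (√2 : ℝ) * conj (e α) * v 1 + v 2] := by
  have h1 := e_mul_conj α
  have h2 := sqrt_two_mul_self
  rw [inv_smul_eq_iff, U_smul]
  funext i
  fin_cases i <;> simp
  · generalize conj (e α) = y at *
    generalize e α = x at *
    generalize ((√2 : ℝ) : ℂ) = s at *
    grind
  · generalize conj (e α) = y at *
    generalize e α = x at *
    generalize ((√2 : ℝ) : ℂ) = s at *
    grind
  · generalize conj (e α) = y at *
    generalize e α = x at *
    generalize ((√2 : ℝ) : ℂ) = s at *
    grind

/-- When `N ≠ 0`, this says that `U + U⁻¹` is the scalar `2N + 2` on the orthogonal complement of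
`pU α` and `2` on `pU α` itself. It is the source of the recursion for products along orbits. -/
theorem U_add_U_inv (α : ℝ) (v : Fin 3 → ℂ) : U α • v + (U α)⁻¹ • v =
    (2 * normU α + 2 : ℂ) • v + (-2 * herm (pU α) v) • pU α := by
  have h1 := e_mul_conj α
  have h2 := sqrt_two_mul_self
  rw [U_smul, U_inv_smul, normU_eq]
  funext i
  fin_cases i <;> simp [herm, pU, map_ofNat]
  · generalize conj (e α) = y at *
    generalize e α = x at *
    generalize ((√2 : ℝ) : ℂ) = s at *
    grind
  · generalize conj (e α) = y at *
    generalize e α = x at *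
    generalize ((√2 : ℝ) : ℂ) = s at *
    grind
  · generalize conj (e α) = y at *
    generalize e α = x at *
    generalize ((√2 : ℝ) : ℂ) = s at *
    grind

theorem herm_U (α : ℝ) (v w : Fin 3 → ℂ) : herm (U α • v) (U α • w) = herm v w := by
  have hS (v w : Fin 3 → ℂ) : herm ((S α)⁻¹ • v) ((S α)⁻¹ • w) = herm v w := by
    rw [← herm_S α, smul_inv_smul, smul_inv_smul]
  rw [U, mul_smul, mul_smul, hS, herm_T]

theorem herm_U_inv_right (α : ℝ) (v w : Fin 3 → ℂ) :
    herm v ((U α)⁻¹ • w) = herm (U α • v) w := by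
  rw [← herm_U α, smul_inv_smul]

theorem herm_U_zpow (α : ℝ) (k : ℤ) (v w : Fin 3 → ℂ) :
    herm (U α ^ k • v) (U α ^ k • w) = herm v w := by
  induction k generalizing v w with
  | zero => simp
  | succ k ih => rw [zpow_add_one, mul_smul, mul_smul, ih, herm_U]
  | pred k ih =>
    rw [zpow_sub_one, mul_smul, mul_smul, ih, herm_U_inv_right, smul_inv_smul]

theorem U_zpow_smul_pU (α : ℝ) (k : ℤ) : U α ^ k • pU α = pU α :=
  MulAction.mem_stabilizer_iff.mp
    (Subgroup.zpow_mem _ (MulAction.mem_stabilizer_iff.mpr (U_smul_pU α)) k)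

theorem herm_pU_U_zpow (α : ℝ) (k : ℤ) (v : Fin 3 → ℂ) :
    herm (pU α) (U α ^ k • v) = herm (pU α) v := by
  rw [← herm_U_zpow α k (pU α) v, U_zpow_smul_pU]

theorem herm_U_zpow_rec (α : ℝ) (k : ℤ) (v w : Fin 3 → ℂ) :
    herm v (U α ^ (k + 1) • w) + herm v (U α ^ (k - 1) • w) =
      (2 * normU α + 2) * herm v (U α ^ k • w) - 2 * herm (pU α) w * herm v (pU α) := by
  have h := congrArg (herm v) (U_add_U_inv α (U α ^ k • w))
  simp only [herm_add_right, herm_smul_right, herm_pU_U_zpow, smul_smul] at h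
  rw [add_comm k 1, zpow_add, zpow_one, zpow_sub_one,
    ((Commute.refl (U α)).zpow_left k).inv_right.eq, h]
  ring

theorem herm_U_zpow_neg (α : ℝ) (k : ℤ) (v w : Fin 3 → ℂ) :
    herm v (U α ^ (-k) • w) = conj (herm w (U α ^ k • v)) := by
  rw [herm_conj, ← herm_U_zpow α k v, smul_smul, ← zpow_add, add_neg_cancel, zpow_zero, one_smul]

/-! ### Initial values of the products -/

section Values

variable (α : ℝ)

theorem herm_pU_pU : herm (pU α) (pU α) = normU α := by
  have h1 := e_mul_conj α
  have h2 := sqrt_two_mul_self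
  rw [normU_eq]
  simp [herm, pU, map_ofNat]
  generalize conj (e α) = y at *
  generalize e α = x at *
  generalize ((√2 : ℝ) : ℂ) = s at *
  grind

theorem herm_pV_pV : herm (pV α) (pV α) = normU α := by
  rw [pV, herm_S, herm_pU_pU]

theorem herm_pW_pW : herm (pW α) (pW α) = normU α := by
  rw [pW, sq, mul_smul, herm_S, herm_S, herm_pU_pU]

theorem herm_pU_pV : herm (pU α) (pV α) = -3 / 2 := by
  have h1 := e_mul_conj α
  have h2 := sqrt_two_mul_self
  rw [pV_eq]
  simp [herm, pU, map_ofNat]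
  generalize conj (e α) = y at *
  generalize e α = x at *
  generalize ((√2 : ℝ) : ℂ) = s at *
  grind

theorem herm_pU_pW : herm (pU α) (pW α) = -3 / 2 := by
  have h1 := e_mul_conj α
  have h2 := sqrt_two_mul_self
  rw [pW_eq]
  simp [herm, pU, map_ofNat]
  generalize conj (e α) = y at *
  generalize e α = x at *
  generalize ((√2 : ℝ) : ℂ) = s at *
  grind

theorem herm_pV_pU : herm (pV α) (pU α) = -3 / 2 := by
  rw [← herm_conj, herm_pU_pV]; simp [map_ofNat]

theorem herm_pW_pU : herm (pW α) (pU α) = -3 / 2 := by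
  rw [← herm_conj, herm_pU_pW]; simp [map_ofNat]

theorem herm_pV_pW : herm (pV α) (pW α) = -3 / 2 := by
  rw [pV, pW, sq, mul_smul, herm_S]
  exact herm_pU_pV α

theorem herm_pV_U_inv_pW : herm (pV α) ((U α)⁻¹ • pW α) = -3 / 2 := by
  rw [herm_U_inv_right, U_smul, pV_eq, pW_eq]
  have h1 := e_mul_conj α
  have h2 := sqrt_two_mul_self
  simp [herm, map_ofNat]
  generalize conj (e α) = y at *
  generalize e α = x at *
  generalize ((√2 : ℝ) : ℂ) = s at *
  grind

theorem herm_pV_U_pV :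
    herm (pV α) (U α • pV α) = 2 * conj (e α) ^ 4 + 4 * conj (e α) ^ 2 + 1 / 2 := by
  rw [U_smul, pV_eq]
  have h1 := e_mul_conj α
  have h2 := sqrt_two_mul_self
  simp [herm, map_ofNat]
  generalize conj (e α) = y at *
  generalize e α = x at *
  generalize ((√2 : ℝ) : ℂ) = s at *
  grind

theorem herm_pW_U_pW :
    herm (pW α) (U α • pW α) = 2 * e α ^ 4 + 4 * e α ^ 2 + 1 / 2 := by
  rw [U_smul, pW_eq]
  have h1 := e_mul_conj α
  have h2 := sqrt_two_mul_self
  simp [herm, map_ofNat]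
  generalize conj (e α) = y at *
  generalize e α = x at *
  generalize ((√2 : ℝ) : ℂ) = s at *
  grind

end Values

/-! ### Consequences of loxodromy -/

theorem norm_e (α : ℝ) : ‖e α‖ = 1 := by
  rw [e, Complex.norm_exp_ofReal_mul_I]

theorem normU_le (α : ℝ) : normU α ≤ 5 / 2 := by
  have h : (e α ^ 2).re ≤ 1 := (Complex.re_le_norm _).trans (by simp [norm_e])
  rw [normU]
  linarith

theorem pU_ne_zero (α : ℝ) : pU α ≠ 0 := fun h => by simpa [pU] using congrFun h 0

theorem U_smul_mk_pU (α : ℝ) : U α • Projectivization.mk ℂ (pU α) (pU_ne_zero α) =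
    Projectivization.mk ℂ (pU α) (pU_ne_zero α) := by
  rw [Projectivization.smul_mk]
  simp only [U_smul_pU]

/-- The vectors fixed by `U` are the multiples of `pU`. -/
theorem exists_smul_pU_of_fixed {α : ℝ} {v : Fin 3 → ℂ} (h : T α • v = S α • v) :
    ∃ c : ℂ, c • pU α = v := by
  have h1 := e_mul_conj α
  have h2 := sqrt_two_mul_self
  rw [T_smul, S_smul] at h
  have ha := congrFun h 0
  have hb := congrFun h 2
  simp at ha hb
  refine ⟨v 0, ?_⟩
  funext i
  fin_cases i <;> simp [pU]
  all_goals
    generalize conj (e α) = y at *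
    generalize e α = x at *
    generalize ((√2 : ℝ) : ℂ) = s at *
    grind

/-- The characteristic polynomial of `U`, evaluated at an eigenvalue. -/
theorem eigenvalue_eq {α : ℝ} {v : Fin 3 → ℂ} (hv : v ≠ 0) {μ : ℂ}
    (h : T α • v = μ • S α • v) : (1 - μ) * (μ ^ 2 - (2 * normU α + 2) * μ + 1) = 0 := by
  have h1 := e_mul_conj α
  have h2 := sqrt_two_mul_self
  rw [T_smul, S_smul] at h
  have ha := congrFun h 0
  have hb := congrFun h 1
  have hc := congrFun h 2
  simp at ha hb hc
  rw [normU_eq]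
  -- The multipliers of the three equations are the cofactors of `T - μS`, so each coordinate of `v`
  -- is killed by its determinant.
  have key : ∀ i, (1 - μ) * (μ ^ 2 - (2 * (1 / 2 + e α ^ 2 + conj (e α) ^ 2) + 2) * μ + 1) * v i
      = 0 := by
    intro i
    fin_cases i <;> simp
    · have hl := congrArg₂ (· + ·) (congrArg₂ (· + ·)
        (congrArg ((μ + 1) * ·) ha)
        (congrArg ((μ * ((√2 : ℝ) * conj (e α)) + (√2 : ℝ) * e α * (μ - 1)) * ·) hb))
        (congrArg ((2 * μ * conj (e α) ^ 2 - (μ - 1) ^ 2) * ·) hc)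
      generalize conj (e α) = y at *
      generalize e α = x at *
      generalize ((√2 : ℝ) : ℂ) = s at *
      clear ha hb hc
      grind
    · have hl := congrArg₂ (· + ·) (congrArg₂ (· + ·)
        (congrArg ((-(μ * ((√2 : ℝ) * e α) + (√2 : ℝ) * conj (e α) * (μ - 1))) * ·) ha)
        (congrArg ((-μ - (μ - 1) ^ 2) * ·) hb))
        (congrArg ((-(μ * ((√2 : ℝ) * conj (e α)) - μ * ((√2 : ℝ) * e α) * (μ - 1))) * ·) hc)
      generalize conj (e α) = y at *
      generalize e α = x at *
      generalize ((√2 : ℝ) : ℂ) = s at *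
      clear ha hb hc
      grind
    · have hl := congrArg₂ (· + ·) (congrArg₂ (· + ·)
        (congrArg ((2 * μ * e α ^ 2 - (μ - 1) ^ 2) * ·) ha)
        (congrArg ((μ * ((√2 : ℝ) * e α) - μ * ((√2 : ℝ) * conj (e α)) * (μ - 1)) * ·) hb))
        (congrArg ((μ ^ 2 + μ) * ·) hc)
      generalize conj (e α) = y at *
      generalize e α = x at *
      generalize ((√2 : ℝ) : ℂ) = s at *
      clear ha hb hc
      grind
  obtain ⟨i, hi⟩ := Function.ne_iff.mp hv
  exact (mul_eq_zero.mp (key i)).resolve_right hi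

/-- If `N < 0`, then `[pU]` is a fixed point inside the complex hyperbolic plane. If `N = 0`, the
only eigenvalue is `1`, with eigenline spanned by `pU α`, so there is at most one boundary fixed
point. -/
theorem normU_pos {α : ℝ} (hU : IsLoxodromic (U α)) : 0 < normU α := by
  have hre : (herm (pU α) (pU α)).re = normU α := by rw [herm_pU_pU, Complex.ofReal_re]
  by_contra hN
  rcases lt_or_eq_of_le (not_lt.mp hN) with h | h
  · exact hU.1 _ ((mk_mem_H2 _ (pU_ne_zero α)).mpr (hre.trans_lt h)) (U_smul_mk_pU α)
  · have hall : {x : CP2 | x ∈ bdryH2 ∧ U α • x = x} ⊆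
        {Projectivization.mk ℂ (pU α) (pU_ne_zero α)} := by
      rintro x ⟨-, hx⟩
      induction x using Projectivization.ind with
      | h v hv =>
        rw [Projectivization.smul_mk, Projectivization.mk_eq_mk_iff'] at hx
        obtain ⟨μ, hμ⟩ := hx
        have hT : T α • v = μ • S α • v := by
          have h3 := congrArg (S α • ·) hμ
          simp only [U, mul_smul, smul_inv_smul] at h3
          rw [← h3, smul_comm]
        have hμ1 : (1 - μ) ^ 3 = 0 := by
          have := eigenvalue_eq hv hT
          rw [h] at this
          rw [← this]
          push_cast
          ring
        have hμ2 : μ = 1 := (sub_eq_zero.mp (pow_eq_zero_iff (by norm_num) |>.mp hμ1)).symm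
        rw [hμ2, one_smul] at hT
        rw [Set.mem_singleton_iff, Projectivization.mk_eq_mk_iff']
        exact exists_smul_pU_of_fixed hT
    have h2 := Set.ncard_le_ncard hall
    rw [hU.2, Set.ncard_singleton] at h2
    norm_num at h2

/-! ### Growth of the products along orbits -/

theorem gramDet_neg {N : ℝ} {g : ℂ} (hN : 0 < N) (hg : 3 * N + 6 < ‖g‖)
    (h : g.re ≤ N ∨ 1 ≤ N) : gramDet N g < 0 := by
  rw [gramDet]
  rcases h with h | h
  · nlinarith [mul_pos hN (show 0 < ‖g‖ ^ 2 - N ^ 2 by nlinarith)]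
  -- Replacing `g.re` by `‖g‖` only increases the determinant, and the result is `-(‖g‖ - N)(N(‖g‖ +
  -- N) - 9/2)`.
  · have h1 := Complex.re_le_norm g
    have h2 : 0 < N * (‖g‖ + N) - 9 / 2 := by nlinarith
    have h3 : 0 < ‖g‖ - N := by linarith
    nlinarith [mul_pos h2 h3]

/-- The recursion of the products `⟨p_V, U^k p_W⟩` has a real, strictly decreasing solution. -/
theorem exists_real_of_rec {N : ℝ} (hN : 0 < N) {f : ℕ → ℂ}
    (hrec : ∀ n, f (n + 2) + f n = (2 * N + 2) * f (n + 1) - 9 / 2)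
    (h0 : f 0 = -3 / 2) (h1 : f 1 = (-(3 * N + 6) : ℝ)) (n : ℕ) :
    ∃ c d : ℝ, f (n + 1) = c ∧ f (n + 2) = d ∧ d < c ∧ c ≤ -(3 * N + 6) := by
  induction n with
  | zero =>
    refine ⟨-(3 * N + 6), (2 * N + 2) * -(3 * N + 6) - 9 / 2 + 3 / 2, h1, ?_, by nlinarith, le_rfl⟩
    have h := hrec 0
    rw [zero_add, h0, h1] at h
    push_cast at h ⊢
    linear_combination h
  | succ n ih =>
    obtain ⟨c, d, hc, hd, hlt, hle⟩ := ih
    -- The next difference is `(d - c) + 2Nd - 9/2`, negative because `d < c` and `d < 0`.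
    refine ⟨d, (2 * N + 2) * d - 9 / 2 - c, hd, ?_, by nlinarith, by linarith⟩
    have h := hrec (n + 1)
    rw [add_assoc n 1 1, show 1 + 1 = 2 from rfl, hc, hd] at h
    push_cast
    linear_combination h

theorem lt_norm_of_rec {N : ℝ} (hN : 0 < N) {f : ℕ → ℂ}
    (hrec : ∀ n, f (n + 2) + f n = (2 * N + 2) * f (n + 1) - 9 / 2)
    (h0 : f 0 = -3 / 2) (h1 : f 1 = (-(3 * N + 6) : ℝ)) (n : ℕ) :
    3 * N + 6 < ‖f (n + 2)‖ ∧ (f (n + 2)).re ≤ N := by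
  obtain ⟨c, d, -, hd, hlt, hle⟩ := exists_real_of_rec hN hrec h0 h1 n
  rw [hd, Complex.norm_real, Complex.ofReal_re]
  exact ⟨(by linarith : 3 * N + 6 < -d).trans_le (neg_le_abs d), by linarith⟩

/-- Growth of a sequence with the recursion and the initial values of `⟨p_V, U^k p_V⟩`. -/
theorem lt_norm_of_rec' {N : ℝ} (hN : 0 < N) (hN' : N ≤ 5 / 2) {f : ℕ → ℂ}
    (hrec : ∀ n, f (n + 2) + f n = (2 * N + 2) * f (n + 1) - 9 / 2)
    (h0 : f 0 = N) (h1 : (f 1).re = N ^ 2 + N - 9 / 4)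
    (h1' : (f 1).im ^ 2 = (5 - 2 * N) * (2 * N + 3) ^ 3 / 16) (n : ℕ) :
    3 * N + 6 < ‖f (n + 2)‖ ∧ ((f (n + 2)).re ≤ N ∨ 1 ≤ N) := by
  have hre (n : ℕ) : (f (n + 2)).re = (2 * N + 2) * (f (n + 1)).re - 9 / 2 - (f n).re := by
    have := congrArg Complex.re (hrec n)
    simp at this
    linarith
  have him (n : ℕ) : (f (n + 2)).im = (2 * N + 2) * (f (n + 1)).im - (f n).im := by
    have := congrArg Complex.im (hrec n)
    simp at this
    linarith
  have r2 : (f 2).re = 2 * N ^ 3 + 4 * N ^ 2 - 7 / 2 * N - 9 := by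
    rw [hre 0, zero_add, h1, h0, Complex.ofReal_re]; ring
  have i2 : (f 2).im = (2 * N + 2) * (f 1).im := by
    rw [him 0, zero_add, h0, Complex.ofReal_im, sub_zero]
  have n1 : ‖f 1‖ ^ 2 = (N ^ 2 + N - 9 / 4) ^ 2 + (5 - 2 * N) * (2 * N + 3) ^ 3 / 16 := by
    rw [Complex.sq_norm, Complex.normSq_apply, ← sq, ← sq, h1, h1']
  have n2 : ‖f 2‖ ^ 2 = (3 * N + 6) ^ 2 + (18 * N ^ 3 + 91 * N ^ 2 + 297 / 2 * N + 315 / 4) := by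
    rw [Complex.sq_norm, Complex.normSq_apply, ← sq, ← sq, r2, i2, mul_pow, h1']
    ring
  have hg2 : 3 * N + 6 < ‖f 2‖ := lt_of_pow_lt_pow_left₀ 2 (norm_nonneg _) (by
    rw [n2]; exact lt_add_of_pos_right _ (by positivity))
  rcases le_total 1 N with h | h
  -- For `N ≥ 1` the recursion alone makes the moduli nondecreasing: `2N‖f (n + 2)‖` exceeds the
  -- constant `9/2`.
  · have key (n : ℕ) : 3 * N + 6 < ‖f (n + 2)‖ ∧ ‖f (n + 1)‖ ≤ ‖f (n + 2)‖ := by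
      induction n with
      | zero =>
        refine ⟨hg2, le_of_sq_le_sq ?_ (norm_nonneg _)⟩
        rw [zero_add, n1, n2]
        nlinarith [pow_pos hN 3]
      | succ n ih =>
        obtain ⟨ih1, ih2⟩ := ih
        have h3 : (2 * N + 2) * ‖f (n + 2)‖ ≤ ‖f (n + 3)‖ + ‖f (n + 1)‖ + 9 / 2 := by
          have h4 : (2 * N + 2 : ℂ) * f (n + 2) = f (n + 3) + f (n + 1) + 9 / 2 := by
            linear_combination -hrec (n + 1)
          have h5 : ‖(2 * N + 2 : ℂ)‖ = 2 * N + 2 := by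
            rw [show (2 * N + 2 : ℂ) = ((2 * N + 2 : ℝ) : ℂ) by push_cast; rfl, Complex.norm_real,
              Real.norm_of_nonneg (by positivity)]
          rw [← h5, ← norm_mul, h4]
          refine (norm_add₃_le).trans ?_
          norm_num
        have h6 : ‖f (n + 2)‖ ≤ ‖f (n + 3)‖ := by nlinarith
        exact ⟨ih1.trans_le h6, h6⟩
    exact ⟨(key n).1, Or.inr h⟩
  -- For `N ≤ 1` real and imaginary parts are treated separately: the real part is nonpositive and
  -- nonincreasing from index `2` on, and the imaginary part does not shrink in absolute value.
  · have hN1 : 0 ≤ N * (1 - N) := mul_nonneg hN.le (sub_nonneg.mpr h)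
    have hN2 : 0 ≤ N ^ 2 * (1 - N) := mul_nonneg (sq_nonneg N) (sub_nonneg.mpr h)
    have h2neg : (f 2).re ≤ 0 := by
      rw [r2]
      nlinarith
    have keyr (n : ℕ) : (f (n + 2)).re ≤ (f 2).re ∧ (f (n + 2)).re ≤ (f (n + 1)).re := by
      induction n with
      | zero =>
        refine ⟨le_rfl, ?_⟩
        rw [zero_add, r2, h1]
        nlinarith
      | succ n ih =>
        obtain ⟨ih1, ih2⟩ := ih
        have h8 := hre (n + 1)
        have h9 : (f (n + 3)).re ≤ (f (n + 2)).re := by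
          rw [h8]
          nlinarith [mul_nonneg hN.le (neg_nonneg.mpr (ih1.trans h2neg))]
        exact ⟨h9.trans ih1, h9⟩
    have keyi (n : ℕ) : ∃ s t : ℝ, 0 ≤ s ∧ s ≤ t ∧ 1 ≤ t ∧ (f (n + 1)).im = s * (f 2).im ∧
        (f (n + 2)).im = t * (f 2).im := by
      induction n with
      | zero =>
        -- As `f 0` is real, `(f 2).im = (2N + 2) (f 1).im`, whence the first ratio.
        refine ⟨(2 * N + 2)⁻¹, 1, by positivity, inv_le_one_of_one_le₀ (by linarith), le_rfl, ?_,
          by simp⟩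
        rw [zero_add, i2]
        field_simp
      | succ n ih =>
        obtain ⟨s, t, hs, hst, ht, h3, h4⟩ := ih
        refine ⟨t, (2 * N + 2) * t - s, by linarith, by nlinarith, by nlinarith, h4, ?_⟩
        rw [him (n + 1), h4, h3]
        ring
    have hr := (keyr n).1
    obtain ⟨-, t, -, -, ht, -, hi⟩ := keyi n
    refine ⟨hg2.trans_le (le_of_sq_le_sq ?_ (norm_nonneg _)), Or.inl (by linarith)⟩
    rw [Complex.sq_norm, Complex.sq_norm, Complex.normSq_apply, Complex.normSq_apply, hi]
    have hr2 := mul_self_le_mul_self (neg_nonneg.mpr h2neg) (neg_le_neg hr)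
    have ht2 : 0 ≤ t * t - 1 := sub_nonneg.mpr (one_le_mul_of_one_le_of_one_le ht ht)
    linear_combination hr2 + mul_nonneg ht2 (mul_self_nonneg (f 2).im)

theorem herm_pV_U_pV_re (α : ℝ) :
    (herm (pV α) (U α • pV α)).re = normU α ^ 2 + normU α - 9 / 4 := by
  have h1 := e_mul_conj α
  have h2 : (herm (pV α) (U α • pV α) + conj (herm (pV α) (U α • pV α)) : ℂ) =
      2 * (normU α ^ 2 + normU α - 9 / 4) := by
    rw [herm_pV_U_pV, normU_eq]
    simp only [map_add, map_mul, map_pow, map_div₀, map_ofNat, map_one, Complex.conj_conj]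
    linear_combination (-4 - 4 * e α * conj (e α)) * h1
  rw [Complex.add_conj] at h2
  have h3 : 2 * (herm (pV α) (U α • pV α)).re = 2 * (normU α ^ 2 + normU α - 9 / 4) := by
    apply Complex.ofReal_injective
    push_cast at h2 ⊢
    exact h2
  linarith

theorem herm_pV_U_pV_im_sq (α : ℝ) : (herm (pV α) (U α • pV α)).im ^ 2 =
    (5 - 2 * normU α) * (2 * normU α + 3) ^ 3 / 16 := by
  have h1 := e_mul_conj α
  have h0 := herm_pV_U_pV α
  generalize herm (pV α) (U α • pV α) = g at *
  have h2 : 2 * conj (e α) ^ 4 + 4 * conj (e α) ^ 2 - 2 * e α ^ 4 - 4 * e α ^ 2 =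
      2 * (g.im : ℂ) * Complex.I := by
    have h3 := Complex.sub_conj g
    nth_rw 1 2 [h0] at h3
    simp only [map_add, map_mul, map_pow, map_div₀, map_ofNat, map_one, Complex.conj_conj] at h3
    push_cast at h3
    rw [← h3]
    ring
  apply Complex.ofReal_injective
  push_cast
  rw [normU_eq]
  clear h0
  generalize (g.im : ℂ) = b at *
  have hI := Complex.I_sq
  generalize conj (e α) = y at *
  generalize e α = x at *
  have h3 : 4 * b ^ 2 = -(2 * y ^ 4 + 4 * y ^ 2 - 2 * x ^ 4 - 4 * x ^ 2) ^ 2 := by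
    rw [h2]
    linear_combination (4 * b ^ 2) * hI
  clear h2 hI
  grind

theorem herm_pW_U_pW_eq_conj (α : ℝ) :
    herm (pW α) (U α • pW α) = conj (herm (pV α) (U α • pV α)) := by
  rw [herm_pW_U_pW, herm_pV_U_pV]
  simp [map_ofNat]

theorem gramTriple (α : ℝ) {v w : Fin 3 → ℂ} (k : ℤ)
    (hv : herm v v = normU α) (hw : herm w w = normU α)
    (hv' : herm (pU α) v = -3 / 2) (hw' : herm (pU α) w = -3 / 2) :
    GramTriple (normU α) (herm v (U α ^ k • w)) (pU α) v (U α ^ k • w) where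
  pp := herm_pU_pU α
  qq := hv
  rr := by rw [herm_U_zpow, hw]
  pq := hv'
  pr := by rw [herm_pU_U_zpow, hw']
  qr := rfl

theorem herm_rec {α : ℝ} {v w : Fin 3 → ℂ} (hv' : herm v (pU α) = -3 / 2)
    (hw' : herm (pU α) w = -3 / 2) (k : ℤ) :
    herm v (U α ^ (k + 1) • w) + herm v (U α ^ (k - 1) • w) =
      (2 * normU α + 2) * herm v (U α ^ k • w) - 9 / 2 := by
  rw [herm_U_zpow_rec, hv', hw']
  ring

theorem norm_bound_pV_pV {α : ℝ} (hN : 0 < normU α) (n : ℕ) :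
    3 * normU α + 6 < ‖herm (pV α) (U α ^ ((n : ℤ) + 2) • pV α)‖ ∧
      ((herm (pV α) (U α ^ ((n : ℤ) + 2) • pV α)).re ≤ normU α ∨ 1 ≤ normU α) := by
  have h := lt_norm_of_rec' hN (normU_le α) (f := fun n : ℕ => herm (pV α) (U α ^ (n : ℤ) • pV α))
    (fun n => by
      have := herm_rec (herm_pV_pU α) (herm_pU_pV α) (n + 1)
      rw [add_assoc, add_sub_cancel_right] at this
      exact_mod_cast this)
    (by simp [herm_pV_pV]) (by simpa using herm_pV_U_pV_re α)
    (by simpa using herm_pV_U_pV_im_sq α) n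
  exact_mod_cast h

theorem norm_bound_pW_pW {α : ℝ} (hN : 0 < normU α) (n : ℕ) :
    3 * normU α + 6 < ‖herm (pW α) (U α ^ ((n : ℤ) + 2) • pW α)‖ ∧
      ((herm (pW α) (U α ^ ((n : ℤ) + 2) • pW α)).re ≤ normU α ∨ 1 ≤ normU α) := by
  have h := lt_norm_of_rec' hN (normU_le α) (f := fun n : ℕ => herm (pW α) (U α ^ (n : ℤ) • pW α))
    (fun n => by
      have := herm_rec (herm_pW_pU α) (herm_pU_pW α) (n + 1)
      rw [add_assoc, add_sub_cancel_right] at this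
      exact_mod_cast this)
    (by simp [herm_pW_pW])
    (by simpa [herm_pW_U_pW_eq_conj] using herm_pV_U_pV_re α)
    (by simpa [herm_pW_U_pW_eq_conj] using herm_pV_U_pV_im_sq α) n
  exact_mod_cast h

theorem herm_pV_U_pW (α : ℝ) : herm (pV α) (U α • pW α) = (-(3 * normU α + 6) : ℝ) := by
  have h := herm_rec (herm_pV_pU α) (herm_pU_pW α) 0
  simp only [zero_add, zpow_one, zero_sub, zpow_neg_one, zpow_zero, one_smul, herm_pV_U_inv_pW,
    herm_pV_pW] at h
  push_cast
  linear_combination h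

theorem herm_pV_U_neg_two_pW (α : ℝ) :
    herm (pV α) (U α ^ (-2 : ℤ) • pW α) = (-(3 * normU α + 6) : ℝ) := by
  have h := herm_rec (herm_pV_pU α) (herm_pU_pW α) (-1)
  norm_num only [zpow_neg_one, zpow_zero, one_smul, herm_pV_U_inv_pW, herm_pV_pW] at h
  push_cast
  linear_combination h

theorem norm_bound_pV_pW {α : ℝ} (hN : 0 < normU α) (n : ℕ) :
    3 * normU α + 6 < ‖herm (pV α) (U α ^ ((n : ℤ) + 2) • pW α)‖ ∧
      (herm (pV α) (U α ^ ((n : ℤ) + 2) • pW α)).re ≤ normU α := by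
  have h := lt_norm_of_rec hN (f := fun n : ℕ => herm (pV α) (U α ^ (n : ℤ) • pW α))
    (fun n => by
      have := herm_rec (herm_pV_pU α) (herm_pU_pW α) (n + 1)
      rw [add_assoc, add_sub_cancel_right] at this
      exact_mod_cast this)
    (by simp [herm_pV_pW]) (by simpa using herm_pV_U_pW α) n
  exact_mod_cast h

/-- Run backwards from `k = -1`, the sequence satisfies the same recursion with the same two initial
values as forwards from `k = 0`. -/
theorem norm_bound_pV_pW' {α : ℝ} (hN : 0 < normU α) (n : ℕ) :
    3 * normU α + 6 < ‖herm (pV α) (U α ^ (-(n : ℤ) - 3) • pW α)‖ ∧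
      (herm (pV α) (U α ^ (-(n : ℤ) - 3) • pW α)).re ≤ normU α := by
  have h := lt_norm_of_rec hN (f := fun n : ℕ => herm (pV α) (U α ^ (-(n : ℤ) - 1) • pW α))
    (fun n => by
      have := herm_rec (herm_pV_pU α) (herm_pU_pW α) (-((n : ℤ) + 1) - 1)
      rw [show -((n + 2 : ℕ) : ℤ) - 1 = -((n : ℤ) + 1) - 1 - 1 by push_cast; ring,
        show -(n : ℤ) - 1 = -((n : ℤ) + 1) - 1 + 1 by ring,
        show -((n + 1 : ℕ) : ℤ) - 1 = -((n : ℤ) + 1) - 1 by push_cast; ring]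
      linear_combination this)
    (by simp [herm_pV_U_inv_pW])
    (herm_pV_U_neg_two_pW α) n
  push_cast at h
  rwa [show (-((n : ℤ) + 2) - 1) = -(n : ℤ) - 3 by ring] at h

/-! ### Disjoint bisectors -/

theorem bisector_inter_U_zpow_eq_empty {α : ℝ} (hN : 0 < normU α) {v w : Fin 3 → ℂ} (k : ℤ)
    (hv : herm v v = normU α) (hw : herm w w = normU α)
    (hv' : herm (pU α) v = -3 / 2) (hw' : herm (pU α) w = -3 / 2)
    (hg : 3 * normU α + 6 < ‖herm v (U α ^ k • w)‖ ∧
      ((herm v (U α ^ k • w)).re ≤ normU α ∨ 1 ≤ normU α)) :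
    bisector (pU α) v ∩ bisector (pU α) (U α ^ k • w) = ∅ :=
  bisector_inter_eq_empty (gramTriple α k hv hw hv' hw') hN (gramDet_neg hN hg.1 hg.2) hg.1

theorem bound_neg {N : ℝ} {α : ℝ} {k : ℤ} {v : Fin 3 → ℂ}
    (h : 3 * N + 6 < ‖herm v (U α ^ k • v)‖ ∧ ((herm v (U α ^ k • v)).re ≤ N ∨ 1 ≤ N)) :
    3 * N + 6 < ‖herm v (U α ^ (-k) • v)‖ ∧ ((herm v (U α ^ (-k) • v)).re ≤ N ∨ 1 ≤ N) := by
  rwa [herm_U_zpow_neg, RCLike.norm_conj, Complex.conj_re]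

theorem bisector_self_inter_eq_empty {α : ℝ} (hN : 0 < normU α) {v : Fin 3 → ℂ}
    (hv : herm v v = normU α) (hv' : herm (pU α) v = -3 / 2)
    (hg : ∀ n : ℕ, 3 * normU α + 6 < ‖herm v (U α ^ ((n : ℤ) + 2) • v)‖ ∧
      ((herm v (U α ^ ((n : ℤ) + 2) • v)).re ≤ normU α ∨ 1 ≤ normU α))
    {k : ℤ} (hk : 2 ≤ k ∨ k ≤ -2) :
    bisector (pU α) v ∩ bisector (pU α) (U α ^ k • v) = ∅ := by
  apply bisector_inter_U_zpow_eq_empty hN k hv hv hv' hv'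
  rcases hk with hk | hk
  · obtain ⟨n, rfl⟩ : ∃ n : ℕ, k = n + 2 := ⟨(k - 2).toNat, by omega⟩
    exact hg n
  · obtain ⟨n, rfl⟩ : ∃ n : ℕ, k = -((n : ℤ) + 2) := ⟨(-k - 2).toNat, by omega⟩
    exact bound_neg (hg n)

/-! ### Common points of the bisectors -/

section Points

variable (α : ℝ)

/-- `[pA]` has product of modulus `1` with `pU α`, and moving `U^k` to the other side leaves a
single product to compute. -/
theorem pA_mem (w : Fin 3 → ℂ) (k : ℤ) (h : ‖herm (U α ^ (-k) • ![1, 0, 0]) w‖ = 1) :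
    pA ∈ bisector (pU α) (U α ^ k • w) := by
  rw [pA, mk_mem_bisector, ← herm_U_zpow α (-k) _ (U α ^ k • w), smul_smul, ← zpow_add,
    neg_add_cancel, zpow_zero, one_smul, h]
  simp [herm, pU, norm_e]

theorem pB_mem (w : Fin 3 → ℂ) (k : ℤ) (h : ‖herm (U α ^ (-k) • ![0, 0, 1]) w‖ = 1) :
    pB ∈ bisector (pU α) (U α ^ k • w) := by
  rw [pB, mk_mem_bisector, ← herm_U_zpow α (-k) _ (U α ^ k • w), smul_smul, ← zpow_add,
    neg_add_cancel, zpow_zero, one_smul, h]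
  simp [herm, pU]

theorem U_smul_mem {x : CP2} {w : Fin 3 → ℂ} {k l : ℤ} (h : x ∈ bisector (pU α) (U α ^ k • w))
    (hkl : l = k + 1) : U α • x ∈ bisector (pU α) (U α ^ l • w) := by
  subst hkl
  induction x using Projectivization.ind with
  | h v hv =>
    rw [Projectivization.smul_mk, mk_mem_bisector]
    rw [mk_mem_bisector] at h
    rw [add_comm, zpow_add, zpow_one, mul_smul, herm_U, herm_U]
    nth_rw 1 [← U_smul_pU]
    rwa [herm_U]

theorem U_inv_smul_mem {x : CP2} {w : Fin 3 → ℂ} {k l : ℤ} (h : x ∈ bisector (pU α) (U α ^ l • w))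
    (hkl : l = k + 1) : (U α)⁻¹ • x ∈ bisector (pU α) (U α ^ k • w) := by
  subst hkl
  induction x using Projectivization.ind with
  | h v hv =>
    rw [Projectivization.smul_mk, mk_mem_bisector, ← herm_U α, smul_inv_smul,
      ← herm_U α _ (pU α), smul_inv_smul, ← herm_U α _ (U α ^ k • w), smul_inv_smul, U_smul_pU,
      smul_smul, ← zpow_one_add, add_comm 1 k]
    rwa [mk_mem_bisector] at h

theorem norm_herm_U_pA_pV : ‖herm (U α • ![1, 0, 0]) (pV α)‖ = 1 := by
  have h : herm (U α • ![1, 0, 0]) (pV α) = e α ^ 2 := by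
    have h1 := e_mul_conj α
    have h2 := sqrt_two_mul_self
    rw [U_smul, pV_eq]
    simp [herm]
    generalize conj (e α) = y at *
    generalize e α = x at *
    generalize ((√2 : ℝ) : ℂ) = s at *
    grind
  rw [h, norm_pow, norm_e, one_pow]

theorem norm_herm_U_pB_pW : ‖herm (U α • ![0, 0, 1]) (pW α)‖ = 1 := by
  have h : herm (U α • ![0, 0, 1]) (pW α) = 1 := by
    have h1 := e_mul_conj α
    have h2 := sqrt_two_mul_self
    rw [U_smul, pW_eq]
    simp [herm, map_ofNat]
    generalize conj (e α) = y at *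
    generalize e α = x at *
    generalize ((√2 : ℝ) : ℂ) = s at *
    grind
  rw [h, norm_one]

theorem norm_herm_U_inv_pB_pV : ‖herm ((U α)⁻¹ • ![0, 0, 1]) (pV α)‖ = 1 := by
  have h : herm ((U α)⁻¹ • ![0, 0, 1]) (pV α) = 1 := by
    have h1 := e_mul_conj α
    have h2 := sqrt_two_mul_self
    rw [U_inv_smul, pV_eq]
    simp [herm]
    generalize conj (e α) = y at *
    generalize e α = x at *
    generalize ((√2 : ℝ) : ℂ) = s at *
    grind
  rw [h, norm_one]

theorem pA_mem_Jplus_zero : pA ∈ Jplus α 0 :=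
  pA_mem α _ _ (by simp [herm, pV_eq])

theorem pA_mem_Jminus_zero : pA ∈ Jminus α 0 :=
  pA_mem α _ _ (by simp [herm, pW_eq, norm_e])

theorem pA_mem_Jplus_neg_one : pA ∈ Jplus α (-1) :=
  pA_mem α _ _ (by simpa using norm_herm_U_pA_pV α)

theorem pB_mem_Jplus_zero : pB ∈ Jplus α 0 :=
  pB_mem α _ _ (by simp [herm, pV_eq, norm_e])

theorem pB_mem_Jminus_zero : pB ∈ Jminus α 0 :=
  pB_mem α _ _ (by simp [herm, pW_eq, norm_e])

theorem pB_mem_Jminus_neg_one : pB ∈ Jminus α (-1) :=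
  pB_mem α _ _ (by simpa using norm_herm_U_pB_pW α)

theorem pB_mem_Jplus_one : pB ∈ Jplus α 1 :=
  pB_mem α _ _ (by simpa using norm_herm_U_inv_pB_pV α)

end Points

/-! ### The intersection pattern -/

theorem Jplus_zero (α : ℝ) : Jplus α 0 = bisector (pU α) (pV α) := by
  rw [Jplus, zpow_zero, one_smul]

theorem Jminus_zero (α : ℝ) : Jminus α 0 = bisector (pU α) (pW α) := by
  rw [Jminus, zpow_zero, one_smul]

theorem Jplus_zero_inter_Jminus_subsingleton {α : ℝ} (hN : 0 < normU α) {k : ℤ}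
    (hk : herm (pV α) (U α ^ k • pW α) = (-(3 * normU α + 6) : ℝ)) :
    (Jplus α 0 ∩ Jminus α k).Subsingleton := by
  have h := gramTriple α k (herm_pV_pV α) (herm_pW_pW α) (herm_pU_pV α) (herm_pU_pW α)
  rw [hk] at h
  rw [Jplus_zero]
  exact bisector_inter_subsingleton h hN

/-- `U` shifts the index of both families by one, so this follows from `[pA]` lying on `J_{-1}^+`
and `J_0^-`. -/
theorem U_smul_pA_mem (α : ℝ) : U α • pA ∈ Jplus α 0 ∩ Jminus α 1 :=
  ⟨U_smul_mem α (pA_mem_Jplus_neg_one α) (by norm_num),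
    U_smul_mem α (pA_mem_Jminus_zero α) (by norm_num)⟩

theorem U_inv_smul_pB_mem (α : ℝ) : (U α)⁻¹ • pB ∈ Jplus α 0 ∩ Jminus α (-2) :=
  ⟨U_inv_smul_mem α (pB_mem_Jplus_one α) (by norm_num),
    U_inv_smul_mem α (pB_mem_Jminus_neg_one α) (by norm_num)⟩

theorem Jplus_inter_Jplus_nonempty_iff {α : ℝ} (hN : 0 < normU α) (k : ℤ) :
    (Jplus α 0 ∩ Jplus α k).Nonempty ↔ k ∈ ({-1, 0, 1} : Set ℤ) := by
  simp only [Set.mem_insert_iff, Set.mem_singleton_iff]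
  constructor
  · intro h
    by_contra hk
    rw [Jplus_zero] at h
    exact h.ne_empty (bisector_self_inter_eq_empty hN (herm_pV_pV α) (herm_pU_pV α)
      (norm_bound_pV_pV hN) (by omega))
  · rintro (rfl | rfl | rfl)
    · exact ⟨pA, pA_mem_Jplus_zero α, pA_mem_Jplus_neg_one α⟩
    · exact ⟨pA, pA_mem_Jplus_zero α, pA_mem_Jplus_zero α⟩
    · exact ⟨U α • pA, U_smul_mem α (pA_mem_Jplus_neg_one α) (by norm_num),
        U_smul_mem α (pA_mem_Jplus_zero α) (by norm_num)⟩

theorem Jminus_inter_Jminus_nonempty_iff {α : ℝ} (hN : 0 < normU α) (k : ℤ) :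
    (Jminus α 0 ∩ Jminus α k).Nonempty ↔ k ∈ ({-1, 0, 1} : Set ℤ) := by
  simp only [Set.mem_insert_iff, Set.mem_singleton_iff]
  constructor
  · intro h
    by_contra hk
    rw [Jminus_zero] at h
    exact h.ne_empty (bisector_self_inter_eq_empty hN (herm_pW_pW α) (herm_pU_pW α)
      (norm_bound_pW_pW hN) (by omega))
  · rintro (rfl | rfl | rfl)
    · exact ⟨pB, pB_mem_Jminus_zero α, pB_mem_Jminus_neg_one α⟩
    · exact ⟨pB, pB_mem_Jminus_zero α, pB_mem_Jminus_zero α⟩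
    · exact ⟨U α • pB, U_smul_mem α (pB_mem_Jminus_neg_one α) (by norm_num),
        U_smul_mem α (pB_mem_Jminus_zero α) (by norm_num)⟩

theorem Jplus_inter_Jminus_nonempty_iff {α : ℝ} (hN : 0 < normU α) (k : ℤ) :
    (Jplus α 0 ∩ Jminus α k).Nonempty ↔ k ∈ ({-2, -1, 0, 1} : Set ℤ) := by
  simp only [Set.mem_insert_iff, Set.mem_singleton_iff]
  constructor
  · intro h
    by_contra hk
    rw [Jplus_zero] at h
    refine h.ne_empty (bisector_inter_U_zpow_eq_empty hN k (herm_pV_pV α) (herm_pW_pW α)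
      (herm_pU_pV α) (herm_pU_pW α) ?_)
    rcases (by omega : 2 ≤ k ∨ k ≤ -3) with hk | hk
    · obtain ⟨n, rfl⟩ : ∃ n : ℕ, k = n + 2 := ⟨(k - 2).toNat, by omega⟩
      exact (norm_bound_pV_pW hN n).imp_right Or.inl
    · obtain ⟨n, rfl⟩ : ∃ n : ℕ, k = -(n : ℤ) - 3 := ⟨(-k - 3).toNat, by omega⟩
      exact (norm_bound_pV_pW' hN n).imp_right Or.inl
  · rintro (rfl | rfl | rfl | rfl)
    · exact ⟨_, U_inv_smul_pB_mem α⟩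
    · exact ⟨pB, pB_mem_Jplus_zero α, pB_mem_Jminus_neg_one α⟩
    · exact ⟨pA, pA_mem_Jplus_zero α, pA_mem_Jminus_zero α⟩
    · exact ⟨_, U_smul_pA_mem α⟩

end ParkerWill

theorem mainTheorem2 (α : ℝ) (hU : ParkerWill.IsLoxodromic (ParkerWill.U α)) :
    (∀ k : ℤ, (ParkerWill.Jplus α 0 ∩ ParkerWill.Jplus α k).Nonempty ↔
      k ∈ ({-1, 0, 1} : Set ℤ)) ∧
    (∀ k : ℤ, (ParkerWill.Jminus α 0 ∩ ParkerWill.Jminus α k).Nonempty ↔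
      k ∈ ({-1, 0, 1} : Set ℤ)) ∧
    (∀ k : ℤ, (ParkerWill.Jplus α 0 ∩ ParkerWill.Jminus α k).Nonempty ↔
      k ∈ ({-2, -1, 0, 1} : Set ℤ)) ∧
    ParkerWill.Jplus α 0 ∩ ParkerWill.Jminus α 1 = {ParkerWill.U α • ParkerWill.pA} ∧
    ParkerWill.Jplus α 0 ∩ ParkerWill.Jminus α (-2) =
      {(ParkerWill.U α)⁻¹ • ParkerWill.pB} := by
  have hN := ParkerWill.normU_pos hU
  refine ⟨ParkerWill.Jplus_inter_Jplus_nonempty_iff hN,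
    ParkerWill.Jminus_inter_Jminus_nonempty_iff hN,
    ParkerWill.Jplus_inter_Jminus_nonempty_iff hN,
    (ParkerWill.Jplus_zero_inter_Jminus_subsingleton hN ?_).eq_singleton_of_mem
      (ParkerWill.U_smul_pA_mem α),
    (ParkerWill.Jplus_zero_inter_Jminus_subsingleton hN
      (ParkerWill.herm_pV_U_neg_two_pW α)).eq_singleton_of_mem (ParkerWill.U_inv_smul_pB_mem α)⟩
  rw [zpow_one, ParkerWill.herm_pV_U_pW]
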